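/- All orders have field $\omega$, and sets are subsets of $\omega$. A *problem* consists of a collection of instances and, for each instance, a collection of solutions (all coded as elements of $\omega^\omega$, with sets coded by their characteristic functions). A problem $\mathsf P$ is *Weihrauch reducible* to a problem $\mathsf Q$, written $\mathsf P\leq_{\mathrm W}\mathsf Q$, if there are Turing functionals $\Phi$ and $\Delta$ such that, whenever $X$ is an instance of $\mathsf P$, $\Phi^X$ is an instance of $\mathsf Q$, and whenever $\widehat Y$ is a solution to $\Phi^X$, $\Delta^{X\oplus\widehat Y}$ is a solution to $X$. Let $\leq_L$ be a linear order on $\omega$. An element $x$ is *small* if $\{y : y<_L x\}$ is finite and *large* if $\{y : x<_L y\}$ is finite; $\leq_L$ is *stable* if each element is small or large. A set $S$ is an *ascending* (respectively *descending*) *sequence* for $\leq_L$ if for all $x,y\in S$, $x\leq y$ implies $x\leq_L y$ (respectively $y\leq_L x$). $\mathsf{SADS}$ is the problem whose instances are the stable linear orders $\leq_L$ on $\omega$ with infinitely many small elements and infinitely many large elements, and whose solutions to $\leq_L$ are the infinite sets that are ascending or descending sequences for $\leq_L$. For $k\geq 1$, a *stable $k$-coloring of pairs* is a map $c$ from $\{\langle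 x,y\rangle\in\omega^2 : x<y\}$ to $\{0,\dots,k-1\}$ such that $\lim_y c(x,y)$ exists for each $x$. A set $H$ is *limit homogeneous* for $c$ if there is a $j<k$ with $\lim_y c(x,y)=j$ for all $x\in H$. $\mathsf D^2$ is the problem whose instances are the stable $k$-colorings of pairs for all $k\geq 1$ (the number $k$ is not given as part of the instance), and whose solutions to $c$ are the infinite limit homogeneous sets for $c$. **Theorem.** $\mathsf{SADS}\nleq_{\mathrm W}\mathsf D^2$. -/

import Mathlib

open Filter

namespace Weihrauch

/-! ## Turing functionals -/

/-- Programs for Turing functionals: programs for the partial recursive functions (composition,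
primitive recursion and unbounded search over the basic functions and the pairing of natural
numbers), with one more basic function, the call of the oracle. -/
inductive OracleCode : Type
  | zero : OracleCode
  | succ : OracleCode
  | left : OracleCode
  | right : OracleCode
  | oracle : OracleCode
  | pair : OracleCode → OracleCode → OracleCode
  | comp : OracleCode → OracleCode → OracleCode
  | prec : OracleCode → OracleCode → OracleCode
  | rfind : OracleCode → OracleCode

/-- `Φ.eval X n` is the (possibly divergent) value `Φ^X(n)` of the functional with program `Φ`,
with oracle `X`, on input `n`. The clauses are those of `Nat.RecursiveIn`. -/
def OracleCode.eval (X : ℕ → ℕ) : OracleCode → ℕ →. ℕ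
  | zero => fun _ => Part.some 0
  | succ => fun n => Part.some (n + 1)
  | left => fun n => Part.some n.unpair.1
  | right => fun n => Part.some n.unpair.2
  | oracle => fun n => Part.some (X n)
  | pair f g => fun n => Nat.pair <$> eval X f n <*> eval X g n
  | comp f g => fun n => eval X g n >>= eval X f
  | prec f g => fun p =>
      p.unpair.2.rec (eval X f p.unpair.1) fun y IH => do
        let i ← IH
        eval X g (Nat.pair p.unpair.1 (Nat.pair y i))
  | rfind f => fun a => Nat.rfind fun n => (fun m => m = 0) <$> eval X f (Nat.pair a n)

/-- `Φ^X` is total and equal to `Y`. -/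
def OracleCode.Computes (Φ : OracleCode) (X Y : ℕ → ℕ) : Prop :=
  ∀ n, Φ.eval X n = Part.some (Y n)

/-- The join `X ⊕ Y`: `X` on the even numbers and `Y` on the odd numbers. -/
def join (X Y : ℕ → ℕ) : ℕ → ℕ := fun n => if n % 2 = 0 then X (n / 2) else Y (n / 2)

/-! ## Problems and Weihrauch reducibility -/

/-- A problem: a collection of instances, together with the solutions to each of them. Instances
and solutions are functions on the natural numbers; a set is given by its characteristic
function. -/
structure Problem where
  Instance : (ℕ → ℕ) → Prop
  Solution : (ℕ → ℕ) → (ℕ → ℕ) → Prop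

/-- `P ≤_W Q`: there are Turing functionals `Φ` and `Δ` such that, if `X` is any instance of `P`,
then `Φ^X` is an instance of `Q`, and if `Yhat` is any solution to `Φ^X`, then `Δ^(X ⊕ Yhat)` is a
solution to `X`. -/
def WeihrauchReducible (P Q : Problem) : Prop :=
  ∃ Φ Δ : OracleCode, ∀ X, P.Instance X →
    ∃ Xhat, Φ.Computes X Xhat ∧ Q.Instance Xhat ∧
      ∀ Yhat, Q.Solution Xhat Yhat → ∃ Y, Δ.Computes (join X Yhat) Y ∧ P.Solution X Y

/-- The characteristic function of a set of natural numbers. -/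
noncomputable def charFun (S : Set ℕ) : ℕ → ℕ := S.indicator 1

/-- The set of codes of the pairs in a binary relation on the natural numbers. -/
def relCode (r : ℕ → ℕ → Prop) : Set ℕ := {n | r n.unpair.1 n.unpair.2}

/-! ## Linear orders with field `ω`; `r x y` is read `x ≤_L y` -/

/-- `x` is small: only finitely many `y` satisfy `y <_L x`. -/
def IsSmall (r : ℕ → ℕ → Prop) (x : ℕ) : Prop := {y | r y x ∧ y ≠ x}.Finite

/-- `x` is large: only finitely many `y` satisfy `x <_L y`. -/
def IsLarge (r : ℕ → ℕ → Prop) (x : ℕ) : Prop := {y | r x y ∧ x ≠ y}.Finite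

/-- A linear order is stable if each element is small or large. -/
def IsStable (r : ℕ → ℕ → Prop) : Prop := ∀ x, IsSmall r x ∨ IsLarge r x

def IsAscendingSequence (r : ℕ → ℕ → Prop) (S : Set ℕ) : Prop :=
  ∀ x ∈ S, ∀ y ∈ S, x ≤ y → r x y

def IsDescendingSequence (r : ℕ → ℕ → Prop) (S : Set ℕ) : Prop :=
  ∀ x ∈ S, ∀ y ∈ S, x ≤ y → r y x

/-- `SADS`: every stable linear order with infinitely many small elements and infinitely many
large elements has an infinite ascending or descending sequence. -/
def SADS : Problem where
  Instance X := ∃ r : ℕ → ℕ → Prop, X = charFun (relCode r) ∧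
    IsLinearOrder ℕ r ∧ IsStable r ∧ {x | IsSmall r x}.Infinite ∧ {x | IsLarge r x}.Infinite
  Solution X Y := ∃ (r : ℕ → ℕ → Prop) (S : Set ℕ), X = charFun (relCode r) ∧ Y = charFun S ∧
    S.Infinite ∧ (IsAscendingSequence r S ∨ IsDescendingSequence r S)

/-! ## Stable colorings of pairs; only the values `c x y` with `x < y` matter -/

/-- `lim_y c(x,y) = j`. -/
def HasLimitColor (c : ℕ → ℕ → ℕ) (x j : ℕ) : Prop := ∀ᶠ y in atTop, c x y = j

/-- `c` is a stable `k`-coloring of pairs. -/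
def IsStableColoring (k : ℕ) (c : ℕ → ℕ → ℕ) : Prop :=
  (∀ x y, x < y → c x y < k) ∧ ∀ x, ∃ j < k, HasLimitColor c x j

/-- `L` is limit homogeneous for the `k`-coloring `c`. -/
def IsLimitHomogeneous (k : ℕ) (c : ℕ → ℕ → ℕ) (L : Set ℕ) : Prop :=
  ∃ j < k, ∀ x ∈ L, HasLimitColor c x j

/-- The coloring of pairs given by a function on codes of pairs. -/
def coloringOf (X : ℕ → ℕ) : ℕ → ℕ → ℕ := fun x y => X (Nat.pair x y)

/-- `D²`: for every `k ≥ 1`, every stable `k`-coloring of pairs has an infinite limit homogeneous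
set. An instance is the coloring alone, without an indication of the number of colors. -/
def D2 : Problem where
  Instance X := ∃ k ≥ 1, IsStableColoring k (coloringOf X)
  Solution X Y := ∃ k ≥ 1, IsStableColoring k (coloringOf X) ∧
    ∃ L : Set ℕ, Y = charFun L ∧ L.Infinite ∧ IsLimitHomogeneous k (coloringOf X) L

end Weihrauch

/-!
A reduction would consist of a coloring `c` that is computed from a linear order, and of a
functional `Δ` that computes an infinite monotone sequence from the order and any infinite limit
homogeneous set of `c`. The proof uses that `Δ` cannot tell where the order is cut into small and
large elements: the same finite part of an order is compatible with many cuts.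

It suffices to consider the orders given by placements of the natural numbers on the real line, at
distinct nonzero positions that tend to `0`; the small elements are those placed below `0`. Basic
open sets of placements are given by conditions, which fix finitely many positions and bound the
distance of all others from `0`. By a Baire category argument (`Condition.exists_generic`), limit
colors can be forced by conditions, and there are a condition `p` and a finite set `J` of colors
such that, below `p`, all large numbers can be forced to have limit colors in `J`, and every color
in `J` can be forced on infinitely many numbers (`IsContinuousColoring.exists_live_colors`).

Fix a condition `q` below `p`. By compactness there is a finite set of large numbers such that
every coloring of it by pairs of elements of `J` has a monochromatic subset `E` from which `Δ`
outputs two numbers `x < y` that are not yet fixed by `q`, having consulted the order only on a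
finite set (`IsSolver.exists_outputs`). This finite order is compatible with `q` both when all new
elements are made large and when they are all made small (`Condition.exists_le_moving_cut`). Extend
each of these two conditions so that it forces the limit colors of the finite set, and apply the
compactness statement to the pair of the two resulting colorings. The set `E` obtained is limit
homogeneous in both situations, and it extends to infinite limit homogeneous sets, as the colors in
`J` are live. If `x` is below `y` in the order, then the output of `Δ` must be an ascending sequence,
although `y` is large in the first situation; otherwise it must be descending, although `y` is small
in the second (`IsSolver.sign_of_outputs`).
-/

namespace Weihrauch

/-! ### Finite use of Turing functionals -/

/-- A convergent oracle computation consults only finitely many values of its oracle. -/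
theorem OracleCode.exists_use (Φ : OracleCode) (X : ℕ → ℕ) :
    ∀ a v, v ∈ Φ.eval X a →
      ∃ u, ∀ X' : ℕ → ℕ, (∀ i < u, X' i = X i) → v ∈ Φ.eval X' a := by
  induction Φ with
  | zero => exact fun a v h => ⟨0, fun X' _ => h⟩
  | succ => exact fun a v h => ⟨0, fun X' _ => h⟩
  | left => exact fun a v h => ⟨0, fun X' _ => h⟩
  | right => exact fun a v h => ⟨0, fun X' _ => h⟩
  | oracle =>
    intro a v h
    refine ⟨a + 1, fun X' hX' => ?_⟩
    simp only [OracleCode.eval, Part.mem_some_iff] at h ⊢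
    rw [h, hX' a (Nat.lt_succ_self a)]
  | pair f g hf hg =>
    intro a v h
    simp only [OracleCode.eval, Seq.seq, Part.map_eq_map, Part.mem_bind_iff,
      Part.mem_map_iff, exists_exists_and_eq_and] at h ⊢
    obtain ⟨y, hy, z, hz, rfl⟩ := h
    obtain ⟨u₁, h₁⟩ := hf a y hy
    obtain ⟨u₂, h₂⟩ := hg a z hz
    exact ⟨max u₁ u₂, fun X' hX' =>
      ⟨y, h₁ X' fun i hi => hX' i (lt_max_of_lt_left hi),
        z, h₂ X' fun i hi => hX' i (lt_max_of_lt_right hi), rfl⟩⟩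
  | comp f g hf hg =>
    intro a v h
    change v ∈ (OracleCode.eval X g a).bind (OracleCode.eval X f) at h
    obtain ⟨y, hy, hv⟩ := Part.mem_bind_iff.1 h
    obtain ⟨u₁, h₁⟩ := hg a y hy
    obtain ⟨u₂, h₂⟩ := hf y v hv
    exact ⟨max u₁ u₂, fun X' hX' => Part.mem_bind_iff.2
      ⟨y, h₁ X' fun i hi => hX' i (lt_max_of_lt_left hi),
        h₂ X' fun i hi => hX' i (lt_max_of_lt_right hi)⟩⟩
  | prec f g hf hg =>
    intro a
    simp only [OracleCode.eval]
    induction a.unpair.2 with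
    | zero => exact fun v h => hf _ v h
    | succ y ih =>
      intro v h
      simp only [Part.bind_eq_bind, Part.mem_bind_iff] at h ⊢
      obtain ⟨i, hi, hv⟩ := h
      obtain ⟨u₁, h₁⟩ := ih i hi
      obtain ⟨u₂, h₂⟩ := hg _ v hv
      exact ⟨max u₁ u₂, fun X' hX' =>
        ⟨i, h₁ X' fun i hi => hX' i (lt_max_of_lt_left hi),
          h₂ X' fun i hi => hX' i (lt_max_of_lt_right hi)⟩⟩
  | rfind f hf =>
    intro a v h
    obtain ⟨hv, hlt⟩ := Nat.mem_rfind.1 h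
    obtain ⟨w, hw, hw0⟩ := (Part.mem_map_iff _).1 hv
    obtain ⟨u₀, h₀⟩ := hf _ w hw
    have key : ∀ m, ∃ u, m < v → ∀ X' : ℕ → ℕ, (∀ i < u, X' i = X i) →
        ∃ b, b ∈ f.eval X' (Nat.pair a m) ∧ decide (b = 0) = false := by
      intro m
      by_cases hm : m < v
      · obtain ⟨b, hb, hb0⟩ := (Part.mem_map_iff _).1 (hlt hm)
        obtain ⟨u, hu⟩ := hf _ b hb
        exact ⟨u, fun _ X' hX' => ⟨b, hu X' hX', hb0⟩⟩
      · exact ⟨0, fun h => absurd h hm⟩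
    choose U hU using key
    refine ⟨max u₀ ((Finset.range v).sup U), fun X' hX' => Nat.mem_rfind.2
      ⟨(Part.mem_map_iff _).2 ⟨w, h₀ X' fun i hi => hX' i (lt_max_of_lt_left hi), hw0⟩,
        fun {m} hm => (Part.mem_map_iff _).2 ?_⟩⟩
    exact hU m hm X' fun i hi => hX' i
      (lt_max_of_lt_right (hi.trans_le (Finset.le_sup (Finset.mem_range.2 hm))))

theorem charFun_injective {A B : Set ℕ} (h : charFun A = charFun B) : A = B :=
  Set.indicator_one_inj ℕ h

theorem charFun_eq_one {S : Set ℕ} {x : ℕ} : charFun S x = 1 ↔ x ∈ S := by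
  classical
  simp [charFun, Set.indicator_apply]

theorem charFun_congr {A B : Set ℕ} {x y : ℕ} (h : x ∈ A ↔ y ∈ B) :
    charFun A x = charFun B y := by
  classical
  simp [charFun, Set.indicator_apply, h]

/-! ### Linear orders given by placements of the natural numbers on the real line -/

/-- A placement of the natural numbers on the real line: distinct nonzero positions that tend to
`0`, infinitely many of them on either side. Ordered by position, the natural numbers form a
stable linear order, whose small elements are those placed below `0` and whose large elements
are those placed above `0`. -/
structure IsPlacement (g : ℕ → ℝ) : Prop where
  injective : Function.Injective g
  ne_zero : ∀ i, g i ≠ 0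
  null : ∀ ε > 0, ∃ N, ∀ i ≥ N, |g i| < ε
  exists_pos : ∀ N, ∃ i ≥ N, 0 < g i
  exists_neg : ∀ N, ∃ i ≥ N, g i < 0

/-- The code of the linear order given by a placement. -/
noncomputable def orderCode (g : ℕ → ℝ) : ℕ → ℕ := charFun (relCode fun x y => g x ≤ g y)

theorem orderCode_congr {g g' : ℕ → ℝ} {u : ℕ}
    (h : ∀ i < u, ∀ j < u, (g i ≤ g j ↔ g' i ≤ g' j)) : ∀ i < u, orderCode g i = orderCode g' i :=
  fun i hi => charFun_congr
    (h _ ((Nat.unpair_left_le i).trans_lt hi) _ ((Nat.unpair_right_le i).trans_lt hi))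

theorem IsPlacement.exists_lt_abs {g : ℕ → ℝ} (hg : IsPlacement g) (x : ℕ) :
    ∃ N, ∀ i ≥ N, |g i| < |g x| := hg.null _ (abs_pos.2 (hg.ne_zero x))

theorem IsPlacement.isSmall {g : ℕ → ℝ} (hg : IsPlacement g) {x : ℕ} (hx : g x < 0) :
    IsSmall (fun x y => g x ≤ g y) x := by
  obtain ⟨N, hN⟩ := hg.exists_lt_abs x
  refine (Set.finite_Iio N).subset fun y hy => ?_
  by_contra hyN
  have h1 := hN y (not_lt.1 hyN)
  have h2 : g y ≤ g x := hy.1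
  rw [abs_of_neg hx, abs_lt] at h1
  linarith

theorem IsPlacement.isLarge {g : ℕ → ℝ} (hg : IsPlacement g) {x : ℕ} (hx : 0 < g x) :
    IsLarge (fun x y => g x ≤ g y) x := by
  obtain ⟨N, hN⟩ := hg.exists_lt_abs x
  refine (Set.finite_Iio N).subset fun y hy => ?_
  by_contra hyN
  have h1 := hN y (not_lt.1 hyN)
  have h2 : g x ≤ g y := hy.1
  rw [abs_of_pos hx, abs_lt] at h1
  linarith

theorem IsPlacement.instance_orderCode {g : ℕ → ℝ} (hg : IsPlacement g) :
    SADS.Instance (orderCode g) := by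
  refine ⟨_, rfl, ?_, fun x => ?_, ?_, ?_⟩
  · exact
      { refl := fun a => le_refl (g a)
        trans := fun a b c => le_trans
        antisymm := fun a b h h' => hg.injective (le_antisymm h h')
        total := fun a b => le_total (g a) (g b) }
  · exact (lt_or_gt_of_ne (hg.ne_zero x)).imp hg.isSmall hg.isLarge
  · refine Set.infinite_of_forall_exists_gt fun N => ?_
    obtain ⟨i, hi, h⟩ := hg.exists_neg (N + 1)
    exact ⟨i, hg.isSmall h, hi⟩
  · refine Set.infinite_of_forall_exists_gt fun N => ?_
    obtain ⟨i, hi, h⟩ := hg.exists_pos (N + 1)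
    exact ⟨i, hg.isLarge h, hi⟩

theorem IsPlacement.neg_of_ascending {g : ℕ → ℝ} (hg : IsPlacement g) {S : Set ℕ}
    (hS : S.Infinite) (h : IsAscendingSequence (fun x y => g x ≤ g y) S) {x : ℕ} (hx : x ∈ S) :
    g x < 0 := by
  by_contra hneg
  obtain ⟨N, hN⟩ := hg.exists_lt_abs x
  obtain ⟨y, hy, hyN⟩ := hS.exists_gt (max x N)
  have h1 := hN y ((le_max_right _ _).trans hyN.le)
  have h2 : g x ≤ g y := h x hx y hy ((le_max_left _ _).trans hyN.le)
  rw [abs_of_nonneg (not_lt.1 hneg), abs_lt] at h1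
  linarith

theorem IsPlacement.pos_of_descending {g : ℕ → ℝ} (hg : IsPlacement g) {S : Set ℕ}
    (hS : S.Infinite) (h : IsDescendingSequence (fun x y => g x ≤ g y) S) {x : ℕ} (hx : x ∈ S) :
    0 < g x := by
  by_contra hpos
  obtain ⟨N, hN⟩ := hg.exists_lt_abs x
  obtain ⟨y, hy, hyN⟩ := hS.exists_gt (max x N)
  have h1 := hN y ((le_max_right _ _).trans hyN.le)
  have h2 : g y ≤ g x := h x hx y hy ((le_max_left _ _).trans hyN.le)
  rw [abs_of_nonpos (not_lt.1 hpos), abs_lt] at h1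
  linarith

theorem exists_isPlacement : ∃ g, IsPlacement g ∧ ∀ i, |g i| < 1 := by
  have habs : ∀ i : ℕ, |(-1 : ℝ) ^ i / (i + 2)| = 1 / (i + 2) := fun i => by
    rw [abs_div, abs_pow, abs_neg, abs_one, one_pow, abs_of_pos (by positivity)]
  refine ⟨fun i => (-1) ^ i / (i + 2), ⟨fun i j h => ?_, fun i => ?_, fun ε hε => ?_,
    fun N => ⟨2 * N, by omega, ?_⟩, fun N => ⟨2 * N + 1, by omega, ?_⟩⟩, fun i => ?_⟩
  · have h' := congrArg abs h
    simp only [habs] at h'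
    have hi : (i : ℝ) + 2 ≠ 0 := by positivity
    have hj : (j : ℝ) + 2 ≠ 0 := by positivity
    field_simp at h'
    have : (i : ℝ) = j := by linarith
    exact_mod_cast this
  · have hi : (i : ℝ) + 2 ≠ 0 := by positivity
    exact div_ne_zero (pow_ne_zero _ (by norm_num)) hi
  · obtain ⟨N, hN⟩ := exists_nat_one_div_lt hε
    refine ⟨N, fun i hi => ?_⟩
    simp only [habs]
    have : (N : ℝ) ≤ i := by exact_mod_cast hi
    exact (one_div_le_one_div_of_le (by positivity) (by linarith)).trans_lt hN
  · simp only [pow_mul]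
    norm_num
    positivity
  · simp only [pow_add, pow_mul]
    norm_num
    exact div_neg_of_neg_of_pos (by norm_num) (by positivity)
  · rw [habs, div_lt_one (by positivity)]
    have : (0 : ℝ) ≤ i := by positivity
    linarith

theorem exists_pos_le_abs {f : ℕ → ℝ} {n : ℕ} (hne : ∀ i < n, f i ≠ 0) {ε : ℝ} (hε : 0 < ε) :
    ∃ δ > 0, δ ≤ ε ∧ ∀ i < n, δ ≤ |f i| := by
  induction n with
  | zero => exact ⟨ε, hε, le_rfl, fun i hi => absurd hi (Nat.not_lt_zero i)⟩
  | succ n ih =>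
    obtain ⟨δ, hδ, h1, h2⟩ := ih fun i hi => hne i (hi.trans (Nat.lt_succ_self n))
    refine ⟨min δ |f n|, lt_min hδ (abs_pos.2 (hne n (Nat.lt_succ_self n))),
      (min_le_left _ _).trans h1, fun i hi => ?_⟩
    rcases Nat.lt_succ_iff_lt_or_eq.1 hi with hi | rfl
    · exact (min_le_left _ _).trans (h2 i hi)
    · exact min_le_right _ _

/-- Any finitely many distinct nonzero positions extend to a placement, with the remaining
positions arbitrarily close to `0`. -/
theorem exists_isPlacement_extending {f : ℕ → ℝ} {n : ℕ}
    (hinj : ∀ i < n, ∀ j < n, f i = f j → i = j) (hne : ∀ i < n, f i ≠ 0) {ε : ℝ} (hε : 0 < ε) :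
    ∃ g, IsPlacement g ∧ (∀ i < n, g i = f i) ∧ ∀ i ≥ n, |g i| < ε := by
  obtain ⟨b, hb, hb1⟩ := exists_isPlacement
  obtain ⟨δ, hδ, hδε, hδf⟩ := exists_pos_le_abs hne hε
  have habs : ∀ i, |δ * b i| < δ := fun i => by
    rw [abs_mul, abs_of_pos hδ]
    nlinarith [hb1 i]
  refine ⟨fun i => if i < n then f i else δ * b i, ⟨fun i j h => ?_, fun i => ?_, fun η hη => ?_,
    fun N => ?_, fun N => ?_⟩, fun i hi => if_pos hi, fun i hi => ?_⟩
  · by_cases hi : i < n <;> by_cases hj : j < n <;> simp only [hi, hj, if_true, if_false] at h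
    · exact hinj i hi j hj h
    · exact absurd (habs j) (by rw [← h]; exact not_lt.2 (hδf i hi))
    · exact absurd (habs i) (by rw [h]; exact not_lt.2 (hδf j hj))
    · exact hb.injective (mul_left_cancel₀ hδ.ne' h)
  · by_cases hi : i < n
    · simpa only [hi, if_true] using hne i hi
    · simpa only [hi, if_false] using mul_ne_zero hδ.ne' (hb.ne_zero i)
  · obtain ⟨N, hN⟩ := hb.null (η / δ) (div_pos hη hδ)
    refine ⟨max N n, fun i hi => ?_⟩
    have hin : ¬ i < n := not_lt.2 ((le_max_right _ _).trans hi)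
    have := hN i ((le_max_left _ _).trans hi)
    rw [lt_div_iff₀ hδ] at this
    simp only [hin, if_false, abs_mul, abs_of_pos hδ]
    linarith
  · obtain ⟨i, hi, h⟩ := hb.exists_pos (max N n)
    refine ⟨i, (le_max_left _ _).trans hi, ?_⟩
    have hin : ¬ i < n := not_lt.2 ((le_max_right _ _).trans hi)
    simpa only [hin, if_false] using mul_pos hδ h
  · obtain ⟨i, hi, h⟩ := hb.exists_neg (max N n)
    refine ⟨i, (le_max_left _ _).trans hi, ?_⟩
    have hin : ¬ i < n := not_lt.2 ((le_max_right _ _).trans hi)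
    simpa only [hin, if_false] using mul_neg_of_pos_of_neg hδ h
  · simp only [not_lt.2 hi, if_false]
    exact (habs i).trans_le hδε

/-! ### Conditions and generic placements -/

/-- A condition for building a placement: the first `length` positions are fixed, and all later
ones are required to be closer to `0` than `radius`. The fixed positions are listed by a
placement `center` that meets the condition itself. -/
structure Condition where
  center : ℕ → ℝ
  length : ℕ
  radius : ℝ
  isPlacement : IsPlacement center
  lt_radius : ∀ i ≥ length, |center i| < radius

namespace Condition

/-- The placements that meet a condition. -/
def carrier (q : Condition) : Set (ℕ → ℝ) :=
  {g | IsPlacement g ∧ (∀ i < q.length, g i = q.center i) ∧ ∀ i ≥ q.length, |g i| < q.radius}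

theorem center_mem (q : Condition) : q.center ∈ q.carrier :=
  ⟨q.isPlacement, fun _ _ => rfl, q.lt_radius⟩

theorem radius_pos (q : Condition) : 0 < q.radius :=
  (abs_nonneg _).trans_lt (q.lt_radius _ le_rfl)

theorem carrier_subset {q q' : Condition} (hl : q.length ≤ q'.length) (hr : q'.radius ≤ q.radius)
    (hc : q'.center ∈ q.carrier) : q'.carrier ⊆ q.carrier := by
  rintro g ⟨hg, h1, h2⟩
  refine ⟨hg, fun i hi => (h1 i (hi.trans_le hl)).trans (hc.2.1 i hi), fun i hi => ?_⟩
  rcases lt_or_ge i q'.length with h | h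
  · rw [h1 i h]
    exact hc.2.2 i hi
  · exact (h2 i h).trans_le hr

/-- `q' ≤ q` if `q'` is at least as restrictive as `q`. -/
instance : Preorder Condition where
  le q' q := q.length ≤ q'.length ∧ q'.radius ≤ q.radius ∧ q'.center ∈ q.carrier
  le_refl q := ⟨le_rfl, le_rfl, q.center_mem⟩
  le_trans _ _ _ h h' := ⟨h'.1.trans h.1, h.2.1.trans h'.2.1,
    carrier_subset h'.1 h'.2.1 h'.2.2 h.2.2⟩

theorem carrier_mono {q q' : Condition} (h : q' ≤ q) : q'.carrier ⊆ q.carrier :=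
  carrier_subset h.1 h.2.1 h.2.2

theorem exists_le_of_mem {q : Condition} {g : ℕ → ℝ} (hg : g ∈ q.carrier) (u : ℕ) :
    ∃ q' ≤ q, u ≤ q'.length ∧ q'.center = g :=
  ⟨⟨g, max u q.length, q.radius, hg.1, fun i hi => hg.2.2 i ((le_max_right _ _).trans hi)⟩,
    ⟨le_max_right _ _, le_rfl, hg⟩, le_max_left _ _, rfl⟩

theorem exists_le_refining (q : Condition) :
    ∃ q' ≤ q, q.length < q'.length ∧ q'.radius ≤ q.radius / 2 ∧
      (∃ i ≥ q.length, i < q'.length ∧ 0 < q'.center i) ∧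
      ∃ i ≥ q.length, i < q'.length ∧ q'.center i < 0 := by
  obtain ⟨N, hN⟩ := q.isPlacement.null _ (half_pos q.radius_pos)
  obtain ⟨i, hi, hi0⟩ := q.isPlacement.exists_pos q.length
  obtain ⟨j, hj, hj0⟩ := q.isPlacement.exists_neg q.length
  refine ⟨⟨q.center, N + i + j + 1, q.radius / 2, q.isPlacement, fun a ha => hN a (by omega)⟩,
    ⟨?_, ?_, q.center_mem⟩, ?_, le_rfl, ⟨i, hi, ?_, hi0⟩, j, hj, ?_, hj0⟩
  · show q.length ≤ N + i + j + 1
    omega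
  · exact (half_lt_self q.radius_pos).le
  all_goals
    dsimp only
    omega

/-- A Baire category theorem: countably many dense requirements are met by a single placement. -/
theorem exists_generic {R : ℕ → Condition → Prop} {p : Condition}
    (hR : ∀ k, ∀ q ≤ p, ∃ q' ≤ q, R k q') :
    ∃ g ∈ p.carrier, ∀ k, ∃ q ≤ p, R k q ∧ g ∈ q.carrier := by
  have step : ∀ (k : ℕ) (q : {q // q ≤ p}), ∃ q'' : {q // q ≤ p}, q''.1 ≤ q.1 ∧
      (∃ q' ≤ p, R k q' ∧ q''.1 ≤ q') ∧ q.1.length < q''.1.length ∧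
      q''.1.radius ≤ q.1.radius / 2 ∧
      (∃ i ≥ q.1.length, i < q''.1.length ∧ 0 < q''.1.center i) ∧
      ∃ i ≥ q.1.length, i < q''.1.length ∧ q''.1.center i < 0 := by
    rintro k ⟨q, hq⟩
    obtain ⟨q', hq', hRq'⟩ := hR k q hq
    obtain ⟨q'', hq'', h1, h2, ⟨i, hi⟩, j, hj⟩ := exists_le_refining q'
    refine ⟨⟨q'', hq''.trans (hq'.trans hq)⟩, hq''.trans hq', ⟨q', hq'.trans hq, hRq', hq''⟩,
      hq'.1.trans_lt h1, ?_, ⟨i, hq'.1.trans hi.1, hi.2⟩, j, hq'.1.trans hj.1, hj.2⟩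
    have := hq'.2.1
    dsimp only
    linarith
  choose next hle hmeet hlen hrad hpos hneg using step
  let Q : ℕ → {q // q ≤ p} := fun k => Nat.rec ⟨p, le_rfl⟩ next k
  have hanti : Antitone fun k => (Q k).1 := antitone_nat_of_succ_le fun k => hle k (Q k)
  have hlenQ : ∀ k, k ≤ (Q k).1.length := by
    intro k
    induction k with
    | zero => exact Nat.zero_le _
    | succ k ih => exact ih.trans_lt (hlen k (Q k))
  have hradQ : ∀ k, (Q k).1.radius ≤ p.radius / 2 ^ k := by
    intro k
    induction k with
    | zero => simp [Q]
    | succ k ih =>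
      refine (hrad k (Q k)).trans ?_
      rw [pow_succ, ← div_div]
      linarith
  let g : ℕ → ℝ := fun i => (Q (i + 1)).1.center i
  have hg : ∀ k, ∀ i < (Q k).1.length, g i = (Q k).1.center i := by
    intro k i hi
    rcases le_total k (i + 1) with h | h
    · exact (hanti h).2.2.2.1 i hi
    · exact ((hanti h).2.2.2.1 i (hlenQ (i + 1))).symm
  have hsmall : ∀ k, ∀ i ≥ (Q k).1.length, |g i| < (Q k).1.radius := by
    intro k i hi
    have h := (hanti (le_max_left k (i + 1))).2.2.2.2 i hi
    rwa [← hg (max k (i + 1)) i ((le_max_right _ _).trans (hlenQ _))] at h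
  have hgp : IsPlacement g := by
    refine ⟨fun i j h => ?_, fun i => (Q (i + 1)).1.isPlacement.ne_zero i, fun ε hε => ?_,
      fun N => ?_, fun N => ?_⟩
    · rw [hg (max i j + 1) i (by have := hlenQ (max i j + 1); omega),
        hg (max i j + 1) j (by have := hlenQ (max i j + 1); omega)] at h
      exact (Q (max i j + 1)).1.isPlacement.injective h
    · obtain ⟨k, hk⟩ := exists_pow_lt_of_lt_one (div_pos hε p.radius_pos) one_half_lt_one
      refine ⟨(Q k).1.length, fun i hi => (hsmall k i hi).trans_le ((hradQ k).trans ?_)⟩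
      rw [lt_div_iff₀ p.radius_pos, one_div, inv_pow] at hk
      rw [div_eq_inv_mul]
      exact hk.le
    · obtain ⟨i, hi, hil, h⟩ := hpos N (Q N)
      exact ⟨i, (hlenQ N).trans hi, by rwa [hg (N + 1) i hil]⟩
    · obtain ⟨i, hi, hil, h⟩ := hneg N (Q N)
      exact ⟨i, (hlenQ N).trans hi, by rwa [hg (N + 1) i hil]⟩
  have hmem : ∀ k, g ∈ (Q k).1.carrier := fun k => ⟨hgp, hg k, hsmall k⟩
  refine ⟨g, hmem 0, fun k => ?_⟩
  obtain ⟨q, hq, hRq, hle'⟩ := hmeet k (Q k)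
  exact ⟨q, hq, hRq, carrier_mono hle' (hmem (k + 1))⟩

end Condition

/-! ### Forcing limit colors -/

/-- A stable coloring that depends continuously on a placement. -/
structure IsContinuousColoring (c : (ℕ → ℝ) → ℕ → ℕ) : Prop where
  stable : ∀ g, IsPlacement g → ∃ k, IsStableColoring k (coloringOf (c g))
  exists_use : ∀ g, IsPlacement g → ∀ a, ∃ u, ∀ g', IsPlacement g' →
    (∀ i < u, g' i = g i) → c g' a = c g a

/-- The condition `q` forces `z` to have limit color `j` in the coloring `c`. -/
def Forces (c : (ℕ → ℝ) → ℕ → ℕ) (q : Condition) (z j : ℕ) : Prop :=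
  ∀ g ∈ q.carrier, HasLimitColor (coloringOf (c g)) z j

theorem Forces.mono {c : (ℕ → ℝ) → ℕ → ℕ} {q q' : Condition} {z j : ℕ} (h : Forces c q z j)
    (hq : q' ≤ q) : Forces c q' z j := fun g hg => h g (Condition.carrier_mono hq hg)

/-- The color `j` is live below `p`: no extension of `p` prevents it from being forced on
arbitrarily large numbers. -/
def IsLive (c : (ℕ → ℝ) → ℕ → ℕ) (p : Condition) (j : ℕ) : Prop :=
  ∀ q ≤ p, ∀ M, ∃ q' ≤ q, ∃ z ≥ M, Forces c q' z j

theorem HasLimitColor.unique {c : ℕ → ℕ → ℕ} {x i j : ℕ} (hi : HasLimitColor c x i)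
    (hj : HasLimitColor c x j) : i = j := by
  obtain ⟨y, h, h'⟩ := (hi.and hj).exists
  exact h.symm.trans h'

namespace IsContinuousColoring

variable {c : (ℕ → ℝ) → ℕ → ℕ}

theorem exists_forces (hc : IsContinuousColoring c) (z : ℕ) (p : Condition) :
    ∃ q ≤ p, ∃ j, Forces c q z j := by
  by_contra! hcon
  -- A generic placement would yield a coloring in which `z` has no limit color.
  obtain ⟨g, hg, hR⟩ := Condition.exists_generic (p := p)
    (R := fun k q => ∃ y ≥ k.unpair.2, ∀ g ∈ q.carrier, c g (Nat.pair z y) ≠ k.unpair.1) (by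
      intro k q hq
      have h := hcon q hq k.unpair.1
      simp only [Forces, not_forall, exists_prop] at h
      obtain ⟨g, hg, hlim⟩ := h
      simp only [HasLimitColor, eventually_atTop, not_exists, not_forall, exists_prop] at hlim
      obtain ⟨y, hy, hne⟩ := hlim k.unpair.2
      obtain ⟨u, hu⟩ := hc.exists_use g hg.1 (Nat.pair z y)
      obtain ⟨q', hq', hul, hcen⟩ := Condition.exists_le_of_mem hg u
      refine ⟨q', hq', y, hy, fun g' hg' => ?_⟩
      rw [hu g' hg'.1 fun i hi => (hg'.2.1 i (hi.trans_le hul)).trans (by rw [hcen])]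
      exact hne)
  obtain ⟨k, -, hk⟩ := hc.stable g hg.1
  obtain ⟨j, -, hj⟩ := hk z
  obtain ⟨y₀, hy₀⟩ := eventually_atTop.1 hj
  obtain ⟨q, -, ⟨y, hy, hne⟩, hgq⟩ := hR (Nat.pair j y₀)
  rw [Nat.unpair_pair] at hy hne
  exact hne g hgq (hy₀ y hy)

/-- The number of colors is bounded on some basic open set of placements. -/
theorem exists_bound (hc : IsContinuousColoring c) (p₀ : Condition) :
    ∃ (p : Condition) (k : ℕ), ∀ q ≤ p, ∀ z, ∃ q' ≤ q, ∃ j < k, Forces c q' z j := by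
  by_contra! hcon
  obtain ⟨g, hg, hR⟩ := Condition.exists_generic (p := p₀)
    (R := fun k q => ∃ z j, k ≤ j ∧ Forces c q z j) (by
      intro k q _
      obtain ⟨q', hq', z, hz⟩ := hcon q k
      obtain ⟨q'', hq'', j, hj⟩ := hc.exists_forces z q'
      exact ⟨q'', hq''.trans hq', z, j, not_lt.1 fun hlt => hz q'' hq'' j hlt hj, hj⟩)
  obtain ⟨k, -, hk⟩ := hc.stable g hg.1
  obtain ⟨q, -, ⟨z, j, hkj, hF⟩, hgq⟩ := hR k
  obtain ⟨i, hik, hi⟩ := hk z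
  exact absurd hik (not_lt.2 ((hF g hgq).unique hi ▸ hkj))

/-- Below some condition, finitely many colors, each of them live, suffice to color all large
numbers. -/
theorem exists_live_colors (hc : IsContinuousColoring c) (p₀ : Condition) :
    ∃ (p : Condition) (N : ℕ) (J : Finset ℕ),
      (∀ q ≤ p, ∀ z ≥ N, ∃ q' ≤ q, ∃ j ∈ J, Forces c q' z j) ∧ ∀ j ∈ J, IsLive c p j := by
  classical
  have hex : ∃ n, ∃ (p : Condition) (N : ℕ) (J : Finset ℕ), J.card = n ∧
      ∀ q ≤ p, ∀ z ≥ N, ∃ q' ≤ q, ∃ j ∈ J, Forces c q' z j := by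
    obtain ⟨p, k, h⟩ := hc.exists_bound p₀
    refine ⟨_, p, 0, Finset.range k, rfl, fun q hq z _ => ?_⟩
    simpa only [Finset.mem_range] using h q hq z
  -- In a set of colors of the least possible size, every color is live.
  obtain ⟨p, N, J, hJ, h⟩ := Nat.find_spec hex
  refine ⟨p, N, J, h, fun j hj => ?_⟩
  by_contra hlive
  simp only [IsLive, not_forall, not_exists, not_and, exists_prop] at hlive
  obtain ⟨q, hq, M, hM⟩ := hlive
  refine Nat.find_min hex (m := (J.erase j).card) (hJ ▸ Finset.card_erase_lt_of_mem hj)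
    ⟨q, max N M, J.erase j, rfl, fun q₁ hq₁ z hz => ?_⟩
  obtain ⟨q₂, hq₂, i, hi, hF⟩ := h q₁ (hq₁.trans hq) z ((le_max_left _ _).trans hz)
  refine ⟨q₂, hq₂, i, Finset.mem_erase.2 ⟨?_, hi⟩, hF⟩
  rintro rfl
  exact hM q₂ (hq₂.trans hq₁) z ((le_max_right _ _).trans hz) hF

end IsContinuousColoring

/-- Finitely many numbers have their limit colors forced by a common condition. -/
theorem exists_forces_all {c : (ℕ → ℝ) → ℕ → ℕ} {p : Condition} {N : ℕ} {J : Finset ℕ}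
    (hJ : ∀ q ≤ p, ∀ z ≥ N, ∃ q' ≤ q, ∃ j ∈ J, Forces c q' z j) {q : Condition} (hq : q ≤ p)
    (M : ℕ) : ∃ q' ≤ q, ∃ l : ℕ → J, ∀ z ≥ N, z < M → Forces c q' z (l z) := by
  induction M with
  | zero =>
    obtain ⟨_, _, j, hj, _⟩ := hJ q hq N le_rfl
    exact ⟨q, le_rfl, fun _ => ⟨j, hj⟩, fun z _ hz => absurd hz (Nat.not_lt_zero z)⟩
  | succ M ih =>
    obtain ⟨q₁, hq₁, l, hl⟩ := ih
    rcases lt_or_ge M N with hMN | hMN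
    · exact ⟨q₁, hq₁, l, fun z hz hzM => by omega⟩
    obtain ⟨q₂, hq₂, j, hj, hF⟩ := hJ q₁ (hq₁.trans hq) M hMN
    refine ⟨q₂, hq₂.trans hq₁, Function.update l M ⟨j, hj⟩, fun z hz hzM => ?_⟩
    rcases Nat.lt_succ_iff_lt_or_eq.1 hzM with h | rfl
    · rw [Function.update_of_ne h.ne]
      exact (hl z hz h).mono hq₂
    · rwa [Function.update_self]

theorem IsLive.exists_infinite {c : (ℕ → ℝ) → ℕ → ℕ} {p q : Condition} {j : ℕ}
    (hj : IsLive c p j) (hq : q ≤ p) :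
    ∃ g ∈ q.carrier, {z | HasLimitColor (coloringOf (c g)) z j}.Infinite := by
  obtain ⟨g, hg, hR⟩ := Condition.exists_generic (p := q)
    (R := fun k q => ∃ z ≥ k, Forces c q z j) fun k q' hq' => hj q' (hq'.trans hq) k
  refine ⟨g, hg, Set.infinite_of_forall_exists_gt fun k => ?_⟩
  obtain ⟨q', -, ⟨z, hz, hF⟩, hgq'⟩ := hR (k + 1)
  exact ⟨z, hF g hgq', hz⟩

/-! ### Functionals that solve the order from limit homogeneous sets -/

/-- The functional `Δ` computes, from the order given by a placement `g` and any infinite limit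
homogeneous set of the coloring `c g`, an infinite ascending or descending sequence. -/
def IsSolver (c : (ℕ → ℝ) → ℕ → ℕ) (Δ : OracleCode) : Prop :=
  ∀ g, IsPlacement g → ∀ H : Set ℕ, H.Infinite →
    (∃ j, ∀ z ∈ H, HasLimitColor (coloringOf (c g)) z j) →
    ∃ S : Set ℕ, S.Infinite ∧ (IsAscendingSequence (fun x y => g x ≤ g y) S ∨
      IsDescendingSequence (fun x y => g x ≤ g y) S) ∧
      ∀ x, x ∈ S ↔ 1 ∈ Δ.eval (join (orderCode g) (charFun H)) x

/-- With the order given by `g` and the set `E` as its oracle, `Δ` puts `x` into the set that it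
computes, and consults the oracle only below `M`. -/
def Outputs (Δ : OracleCode) (g : ℕ → ℝ) (E : Set ℕ) (M x : ℕ) : Prop :=
  ∀ X : ℕ → ℕ, (∀ i < M, X i = join (orderCode g) (charFun E) i) → 1 ∈ Δ.eval X x

theorem join_congr {X X' Y Y' : ℕ → ℕ} {u : ℕ} (hX : ∀ i < u, X i = X' i)
    (hY : ∀ i < u, Y i = Y' i) : ∀ i < u, join X Y i = join X' Y' i := by
  intro i hi
  have h : i / 2 < u := (Nat.div_le_self i 2).trans_lt hi
  simp only [join, hX _ h, hY _ h]

/-- A compactness argument: for some `M`, every coloring of the numbers in `[N, M)` with colors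
in `ι` has a monochromatic set from which `Δ` outputs two numbers that are at least `n`. For
otherwise some coloring of all numbers has no such finite monochromatic set. An infinite set
that is monochromatic for it and limit homogeneous for `c g` then yields no solution. -/
theorem IsSolver.exists_outputs {c : (ℕ → ℝ) → ℕ → ℕ} {Δ : OracleCode} (hΔ : IsSolver c Δ)
    (hc : IsContinuousColoring c) {g : ℕ → ℝ} (hg : IsPlacement g) (ι : Type) [Finite ι]
    (N n : ℕ) :
    ∃ M, ∀ χ : ℕ → ι, ∃ a, ∃ E : Set ℕ, (∀ z ∈ E, N ≤ z ∧ z < M ∧ χ z = a) ∧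
      ∃ x y, n ≤ x ∧ x < y ∧ y < M ∧ Outputs Δ g E M x ∧ Outputs Δ g E M y := by
  by_contra! hcon
  choose χ hχ using hcon
  -- The limit of the counterexamples along an ultrafilter.
  have hlim : ∀ z, ∃ a, ∀ᶠ M in hyperfilter ℕ, χ M z = a := fun z =>
    Ultrafilter.eventually_exists_iff.1 (Eventually.of_forall fun M => ⟨χ M z, rfl⟩)
  choose χ' hχ' using hlim
  obtain ⟨k, -, hk⟩ := hc.stable g hg
  choose l hlk hl using hk
  obtain ⟨⟨a, j⟩, ha⟩ := Finite.exists_infinite_fiber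
    fun z : ℕ => ((χ' z, ⟨l z, hlk z⟩) : ι × Fin k)
  rw [Set.infinite_coe_iff] at ha
  set H : Set ℕ := {z | N ≤ z ∧ χ' z = a ∧ l z = j} with hH
  have hHinf : H.Infinite := by
    refine (ha.sdiff (Set.finite_Iio N)).mono fun z hz => ?_
    have h := hz.1
    simp only [Set.mem_preimage, Set.mem_singleton_iff, Prod.mk.injEq, Fin.ext_iff] at h
    exact ⟨not_lt.1 hz.2, h⟩
  obtain ⟨S, hS, -, hSΔ⟩ := hΔ g hg H hHinf ⟨j, fun z hz => hz.2.2 ▸ hl z⟩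
  obtain ⟨x, hxS, hx⟩ := hS.exists_gt n
  obtain ⟨y, hyS, hy⟩ := hS.exists_gt x
  obtain ⟨u₁, h₁⟩ := Δ.exists_use _ _ _ ((hSΔ x).1 hxS)
  obtain ⟨u₂, h₂⟩ := Δ.exists_use _ _ _ ((hSΔ y).1 hyS)
  set u := u₁ + u₂ + y + 1 with hu
  have hev : ∀ᶠ M in hyperfilter ℕ, ∀ z ∈ Set.Iio u, χ M z = χ' z :=
    (eventually_all_finite (Set.finite_Iio u)).2 fun z _ => hχ' z
  have hlarge : ∀ᶠ M in hyperfilter ℕ, u ≤ M :=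
    (Nat.hyperfilter_le_atTop : (hyperfilter ℕ : Filter ℕ) ≤ atTop) (eventually_ge_atTop u)
  obtain ⟨M, hM, huM⟩ := (hev.and hlarge).exists
  have hHu : ∀ i < u, charFun (H ∩ Set.Iio u) i = charFun H i := fun i hi =>
    charFun_congr ⟨fun h => h.1, fun h => ⟨h, hi⟩⟩
  have hout : ∀ X : ℕ → ℕ, (∀ i < M, X i = join (orderCode g) (charFun (H ∩ Set.Iio u)) i) →
      ∀ i < u, X i = join (orderCode g) (charFun H) i := fun X hX i hi =>
    (hX i (hi.trans_le huM)).trans (join_congr (fun _ _ => rfl) hHu i hi)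
  refine hχ M a (H ∩ Set.Iio u) (fun z hz => ⟨hz.1.1, lt_of_lt_of_le hz.2 huM,
    (hM z hz.2).trans hz.1.2.1⟩) x y hx.le hy (by omega) (fun X hX => ?_) fun X hX => ?_
  · exact h₁ X fun i hi => hout X hX i (by omega)
  · exact h₂ X fun i hi => hout X hX i (by omega)

/-- Suppose that `q` forces all elements of `E` to have the live color `j`, and fixes the order
that is used in an output of `x` and `y` from `E`. As `E` extends to an infinite limit homogeneous
set for some placement that meets `q`, the condition `q` must make `y` small if the output is
ascending, and large if it is descending. -/
theorem IsSolver.sign_of_outputs {c : (ℕ → ℝ) → ℕ → ℕ} {Δ : OracleCode} (hΔ : IsSolver c Δ)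
    {p q : Condition} {j : ℕ} (hj : IsLive c p j) (hq : q ≤ p) {g₀ : ℕ → ℝ} {E : Set ℕ}
    {M x y : ℕ} (hF : ∀ z ∈ E, Forces c q z j)
    (hord : ∀ a < M, ∀ b < M, (g₀ a ≤ g₀ b ↔ q.center a ≤ q.center b)) (hM : M ≤ q.length)
    (hxy : x < y) (hy : y < M) (hxout : Outputs Δ g₀ E M x) (hyout : Outputs Δ g₀ E M y) :
    (g₀ x < g₀ y → q.center y < 0) ∧ (g₀ y < g₀ x → 0 < q.center y) := by
  obtain ⟨g, hg, hinf⟩ := hj.exists_infinite hq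
  have hcen : ∀ a < M, g a = q.center a := fun a ha => hg.2.1 a (ha.trans_le hM)
  have hordg : ∀ a < M, ∀ b < M, (g a ≤ g b ↔ g₀ a ≤ g₀ b) := fun a ha b hb => by
    rw [hcen a ha, hcen b hb, hord a ha b hb]
  set H : Set ℕ := E ∪ ({z | HasLimitColor (coloringOf (c g)) z j} \ Set.Iio M) with hH
  obtain ⟨S, hS, hmono, hSΔ⟩ := hΔ g hg.1 H
    ((hinf.sdiff (Set.finite_Iio M)).mono Set.subset_union_right)
    ⟨j, fun z hz => hz.elim (fun h => hF z h g hg) fun h => h.1⟩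
  have hoverlap : ∀ i < M, join (orderCode g) (charFun H) i = join (orderCode g₀) (charFun E) i :=
    join_congr (orderCode_congr hordg) fun i hi => charFun_congr
      ⟨fun h => h.elim id fun h => absurd hi h.2, fun h => Or.inl h⟩
  have hxS : x ∈ S := (hSΔ x).2 (hxout _ hoverlap)
  have hyS : y ∈ S := (hSΔ y).2 (hyout _ hoverlap)
  rw [← hcen y hy]
  rcases hmono with hmono | hmono
  · refine ⟨fun _ => hg.1.neg_of_ascending hS hmono hyS, fun h => ?_⟩
    exact absurd ((hordg x (hxy.trans hy) y hy).1 (hmono x hxS y hyS hxy.le)) (not_le.2 h)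
  · refine ⟨fun h => ?_, fun _ => hg.1.pos_of_descending hS hmono hyS⟩
    exact absurd ((hordg y hy x (hxy.trans hy)).1 (hmono x hxS y hyS hxy.le)) (not_le.2 h)

/-! ### Moving the cut -/

/-- Below a condition `q` whose fixed positions lie outside its radius, the order of the first `M`
positions of `q.center` can be kept while all those after the first `q.length` are moved to the
same side of `0`, the side of `s` for `s = 1` or `s = -1`. -/
theorem Condition.exists_le_moving_cut {q : Condition}
    (hq : ∀ i < q.length, q.radius ≤ |q.center i|) {M : ℕ} (hM : q.length ≤ M)
    {s : ℝ} (hs : s = 1 ∨ s = -1) :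
    ∃ q' ≤ q, M ≤ q'.length ∧
      (∀ a < M, ∀ b < M, (q.center a ≤ q.center b ↔ q'.center a ≤ q'.center b)) ∧
      ∀ i ≥ q.length, i < M → 0 < s * q'.center i := by
  set r := q.radius
  -- The new positions lie in `(-r, r)`, which is mapped affinely onto `(0, r)` or `(-r, 0)`.
  set f : ℕ → ℝ := fun i => if i < q.length then q.center i else (q.center i + s * r) / 2
  have hr : 0 < r := q.radius_pos
  have hold : ∀ i < q.length, f i = q.center i := fun i hi => if_pos hi
  have hnew : ∀ i ≥ q.length, f i = (q.center i + s * r) / 2 := fun i hi => if_neg (not_lt.2 hi)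
  have hmono : ∀ a b, q.center a < q.center b → f a < f b := by
    intro a b hab
    rcases lt_or_ge a q.length with ha | ha <;> rcases lt_or_ge b q.length with hb | hb
    · rwa [hold a ha, hold b hb]
    · rw [hold a ha, hnew b hb]
      have h1 := abs_lt.1 (q.lt_radius b hb)
      rcases le_abs'.1 (hq a ha) with h2 | h2 <;> rcases hs with rfl | rfl <;> linarith
    · rw [hnew a ha, hold b hb]
      have h1 := abs_lt.1 (q.lt_radius a ha)
      rcases le_abs'.1 (hq b hb) with h2 | h2 <;> rcases hs with rfl | rfl <;> linarith
    · rw [hnew a ha, hnew b hb]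
      linarith
  have hle : ∀ a b, q.center a ≤ q.center b ↔ f a ≤ f b := by
    intro a b
    refine ⟨fun h => ?_, fun h => not_lt.1 fun h' => absurd (hmono b a h') (not_lt.2 h)⟩
    rcases h.lt_or_eq with h | h
    · exact (hmono a b h).le
    · rw [q.isPlacement.injective h]
  have hside : ∀ i ≥ q.length, 0 < s * f i ∧ |f i| < r := by
    intro i hi
    have h1 := abs_lt.1 (q.lt_radius i hi)
    rw [hnew i hi, abs_lt]
    rcases hs with rfl | rfl <;> refine ⟨?_, ?_, ?_⟩ <;> linarith
  obtain ⟨g, hg, hgf, hgr⟩ := exists_isPlacement_extending (f := f) (n := M)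
    (fun i _ j _ h => q.isPlacement.injective
      (le_antisymm ((hle i j).2 h.le) ((hle j i).2 h.ge)))
    (fun i _ => by
      rcases lt_or_ge i q.length with hi | hi
      · rw [hold i hi]
        exact q.isPlacement.ne_zero i
      · exact right_ne_zero_of_mul (hside i hi).1.ne') hr
  refine ⟨⟨g, M, r, hg, hgr⟩, ⟨hM, le_rfl, hg, fun i hi => ?_, fun i hi => ?_⟩, le_rfl,
    fun a ha b hb => ?_, fun i hi hiM => ?_⟩
  · exact (hgf i (hi.trans_le hM)).trans (hold i hi)
  · show |g i| < r
    rcases lt_or_ge i M with h | h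
    · rw [hgf i h]
      exact (hside i hi).2
    · exact hgr i h
  · show _ ↔ g a ≤ g b
    rw [hgf a ha, hgf b hb, hle a b]
  · show 0 < s * g i
    rw [hgf i hiM]
    exact (hside i hi).1

/-- Every condition extends to one whose fixed positions lie outside its radius. -/
theorem Condition.exists_le_separated (p : Condition) :
    ∃ q ≤ p, ∀ i < q.length, q.radius ≤ |q.center i| := by
  obtain ⟨δ, hδ, hδp, hδc⟩ : ∃ δ > 0, δ ≤ p.radius ∧ ∀ i < p.length, δ ≤ |p.center i| :=
    exists_pos_le_abs (fun i _ => p.isPlacement.ne_zero i) p.radius_pos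
  obtain ⟨g, hg, hgc, hgδ⟩ := exists_isPlacement_extending (f := p.center) (n := p.length)
    (fun _ _ _ _ h => p.isPlacement.injective h) (fun i _ => p.isPlacement.ne_zero i) hδ
  refine ⟨⟨g, p.length, δ, hg, hgδ⟩, ⟨le_rfl, hδp, hg, hgc, fun i hi => (hgδ i hi).trans_le hδp⟩,
    fun i hi => ?_⟩
  show δ ≤ |g i|
  rw [hgc i hi]
  exact hδc i hi

/-- No functional solves all orders given by placements from limit homogeneous sets of a coloring
that depends continuously on the placement. -/
theorem IsContinuousColoring.not_isSolver {c : (ℕ → ℝ) → ℕ → ℕ} (hc : IsContinuousColoring c)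
    (Δ : OracleCode) : ¬ IsSolver c Δ := by
  intro hΔ
  obtain ⟨b, hb, hb1⟩ := exists_isPlacement
  obtain ⟨p, N, J, hJ, hlive⟩ := hc.exists_live_colors ⟨b, 0, 1, hb, fun i _ => hb1 i⟩
  obtain ⟨q, hqp, hq⟩ := p.exists_le_separated
  -- `M` is chosen for pairs of colors: one from each of the two ways of moving the cut.
  obtain ⟨M, hM⟩ := hΔ.exists_outputs hc q.isPlacement (J × J) N q.length
  have hlenM : q.length ≤ M := by
    obtain ⟨_, _, _, hj, _⟩ := hJ p le_rfl N le_rfl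
    obtain ⟨_, _, _, x, y, hx, hxy, hy, _⟩ := hM fun _ => (⟨_, hj⟩, ⟨_, hj⟩)
    omega
  obtain ⟨q₁, hq₁, hM₁, hord₁, hpos⟩ := q.exists_le_moving_cut hq hlenM (Or.inl rfl)
  obtain ⟨q₂, hq₂, hM₂, hord₂, hneg⟩ := q.exists_le_moving_cut hq hlenM (Or.inr rfl)
  obtain ⟨s₁, hs₁, l₁, hl₁⟩ := exists_forces_all hJ (hq₁.trans hqp) M
  obtain ⟨s₂, hs₂, l₂, hl₂⟩ := exists_forces_all hJ (hq₂.trans hqp) M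
  -- The set `E` is limit homogeneous below both `s₁` and `s₂`, which need not be compatible.
  obtain ⟨⟨j₁, j₂⟩, E, hE, x, y, hx, hxy, hy, hxout, hyout⟩ := hM fun z => (l₁ z, l₂ z)
  have hcen₁ : ∀ a < M, s₁.center a = q₁.center a := fun a ha => hs₁.2.2.2.1 a (ha.trans_le hM₁)
  have hcen₂ : ∀ a < M, s₂.center a = q₂.center a := fun a ha => hs₂.2.2.2.1 a (ha.trans_le hM₂)
  have key₁ := hΔ.sign_of_outputs (hlive j₁ j₁.2) (hs₁.trans (hq₁.trans hqp))
    (fun z hz => (Prod.mk.inj (hE z hz).2.2).1 ▸ hl₁ z (hE z hz).1 (hE z hz).2.1)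
    (fun a ha b hb => by rw [hcen₁ a ha, hcen₁ b hb, hord₁ a ha b hb]) (hM₁.trans hs₁.1)
    hxy hy hxout hyout
  have key₂ := hΔ.sign_of_outputs (hlive j₂ j₂.2) (hs₂.trans (hq₂.trans hqp))
    (fun z hz => (Prod.mk.inj (hE z hz).2.2).2 ▸ hl₂ z (hE z hz).1 (hE z hz).2.1)
    (fun a ha b hb => by rw [hcen₂ a ha, hcen₂ b hb, hord₂ a ha b hb]) (hM₂.trans hs₂.1)
    hxy hy hxout hyout
  -- Below `s₁` the number `y` is large, so the output is not ascending. Below `s₂` it is small, so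
  -- the output is not descending.
  rw [hcen₁ y hy] at key₁
  rw [hcen₂ y hy] at key₂
  have h₁ := hpos y (hx.trans hxy.le) hy
  have h₂ := hneg y (hx.trans hxy.le) hy
  rcases lt_or_gt_of_ne (q.isPlacement.injective.ne hxy.ne) with h | h
  · linarith [key₁.1 h]
  · linarith [key₂.2 h]

end Weihrauch

theorem mainTheorem4 : ¬ Weihrauch.WeihrauchReducible Weihrauch.SADS Weihrauch.D2 := by
  open Weihrauch in
  rintro ⟨Φ, Δ, h⟩
  have hred : ∀ g, IsPlacement g → _ := fun g hg => h (orderCode g) hg.instance_orderCode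
  choose! c hΦ hinst hsol using hred
  have hc : IsContinuousColoring c := by
    refine ⟨fun g hg => ?_, fun g hg a => ?_⟩
    · obtain ⟨k, -, hk⟩ := hinst g hg
      exact ⟨k, hk⟩
    · obtain ⟨u, hu⟩ := Φ.exists_use (orderCode g) a (c g a) (by
        rw [hΦ g hg a]
        exact Part.mem_some _)
      refine ⟨u, fun g' hg' hgg' => ?_⟩
      have hmem := hu (orderCode g') (orderCode_congr fun i hi j hj => by
        rw [hgg' i hi, hgg' j hj])
      rw [hΦ g' hg' a, Part.mem_some_iff] at hmem
      exact hmem.symm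
  refine hc.not_isSolver Δ fun g hg H hH ⟨j, hj⟩ => ?_
  obtain ⟨k, hk1, hk⟩ := hinst g hg
  obtain ⟨z, hz⟩ := hH.nonempty
  obtain ⟨i, hik, hi⟩ := hk.2 z
  obtain ⟨Y, hY, r, S, hr, rfl, hS, hmono⟩ := hsol g hg (charFun H)
    ⟨k, hk1, hk, H, rfl, hH, j, (hj z hz).unique hi ▸ hik, hj⟩
  obtain rfl : (fun x y => g x ≤ g y) = r := by
    have hrel := charFun_injective hr
    funext x y
    have := Set.ext_iff.1 hrel (Nat.pair x y)
    simpa [relCode] using this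
  refine ⟨S, hS, hmono, fun x => ?_⟩
  rw [hY x, Part.mem_some_iff, eq_comm, charFun_eq_one]
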